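/- Write $\pi(x,\omega)g(t)=e^{2\pi i\,\omega\cdot t}g(t-x)$ for $x,\omega,t\in\mathbb{R}^d$, and let Feichtinger's algebra $S_0(\mathbb{R}^d)$ be the set of all $g\in L^2(\mathbb{R}^d)$ such that $V_gg(z)=\langle g,\pi(z)g\rangle$ is integrable over $z\in\mathbb{R}^{2d}$. For a lattice $\Lambda=M\mathbb{Z}^{2d}$ with $M\in GL(2d,\mathbb{R})$ put $\mathrm{vol}(\Lambda)=|\det M|$; $\Lambda$ is called symplectic if $\Lambda=c\,S\,\mathbb{Z}^{2d}$ with $c>0$ and $S$ a real symplectic $2d\times 2d$ matrix. The Gabor system $\mathcal{G}(g,\Lambda)=\{\pi(\lambda)g : \lambda\in\Lambda\}$ is a frame if there are constants $0<A\le B<\infty$ with $$A\|f\|^2\le\sum_{\lambda\in\Lambda}|\langle f,\pi(\lambda)g\rangle|^2\le B\|f\|^2\qquad\text{for all } f\in L^2(\mathbb{R}^d).$$ **Theorem.** Let $g\in S_0(\mathbb{R}^d)$ be odd, i.e. $g(-t)=-g(t)$, and let $\Lambda\subset\mathbb{R}^{2d}$ be a symplectic lattice with $\mathrm{vol}(\Lambda)=2^{-d}$.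 Then $\mathcal{G}(g,\Lambda)$ is not a frame; more precisely, the lower frame inequality holds for no constant $A>0$, i.e. the optimal lower frame bound is $0$. In particular, for $d=1$ the same conclusion holds for every lattice $\Lambda\subset\mathbb{R}^2$ of density $\mathrm{vol}(\Lambda)^{-1}=2$. -/

import Mathlib

open MeasureTheory
open scoped Matrix ENNReal ComplexConjugate

noncomputable section

namespace GaborOdd

/-- The configuration space `ℝ^d`. -/
abbrev Space (d : ℕ) : Type := EuclideanSpace ℝ (Fin d)

/-- Phase space `ℝ^{2d}`; a point `z = (x, ω)` has time coordinates `x i = z (Sum.inl i)` and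
frequency coordinates `ω i = z (Sum.inr i)`. -/
abbrev Phase (d : ℕ) : Type := Fin d ⊕ Fin d → ℝ

/-- The time component `x` of `z = (x, ω)`. -/
def timePart {d : ℕ} (z : Phase d) : Space d := WithLp.toLp 2 fun i => z (Sum.inl i)

/-- The frequency component `ω` of `z = (x, ω)`. -/
def freqPart {d : ℕ} (z : Phase d) : Space d := WithLp.toLp 2 fun i => z (Sum.inr i)

/-- The time-frequency shift `π(z) g (t) = e^{2 π i ω · t} g (t - x)`, `z = (x, ω)`. -/
def tfShift {d : ℕ} (z : Phase d) (g : Space d → ℂ) (t : Space d) : ℂ :=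
  Complex.exp (2 * Real.pi * Complex.I * (inner ℝ (freqPart z) t : ℝ)) * g (t - timePart z)

/-- The short-time Fourier transform `V_g f (z) = ⟨f, π(z) g⟩ = ∫ f (t) conj (π(z) g (t)) dt`. -/
def stft {d : ℕ} (g f : Space d → ℂ) (z : Phase d) : ℂ :=
  ∫ t, f t * conj (tfShift z g t)

/-- Membership in Feichtinger's algebra `S₀(ℝ^d)`: `g ∈ L²(ℝ^d)` and `V_g g ∈ L¹(ℝ^{2d})`. -/
def MemFeichtinger {d : ℕ} (g : Space d → ℂ) : Prop :=
  MemLp g 2 volume ∧ Integrable (stft g g) volume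

/-- The lattice `M ℤ^{2d}` in phase space. -/
def lattice {d : ℕ} (M : Matrix (Fin d ⊕ Fin d) (Fin d ⊕ Fin d) ℝ) : Set (Phase d) :=
  Set.range fun k : Fin d ⊕ Fin d → ℤ => M *ᵥ fun i => (k i : ℝ)

/-- `M` is a positive multiple of a symplectic matrix, so that `M ℤ^{2d}` is a symplectic
lattice. -/
def IsSymplecticMultiple {d : ℕ} (M : Matrix (Fin d ⊕ Fin d) (Fin d ⊕ Fin d) ℝ) : Prop :=
  ∃ c : ℝ, 0 < c ∧ ∃ S ∈ Matrix.symplecticGroup (Fin d) ℝ, M = c • S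

/-- `A ‖f‖² ≤ ∑_{z ∈ Λ} |⟨f, π(z) g⟩|²` for all `f ∈ L²(ℝ^d)`. -/
def IsLowerFrameBound {d : ℕ} (g : Space d → ℂ) (Λ : Set (Phase d)) (A : ℝ) : Prop :=
  ∀ f : Space d → ℂ, MemLp f 2 volume →
    ENNReal.ofReal A * eLpNorm f 2 volume ^ 2 ≤ ∑' z : Λ, ‖stft g f z‖ₑ ^ 2

/-- `∑_{z ∈ Λ} |⟨f, π(z) g⟩|² ≤ B ‖f‖²` for all `f ∈ L²(ℝ^d)`. -/
def IsUpperFrameBound {d : ℕ} (g : Space d → ℂ) (Λ : Set (Phase d)) (B : ℝ) : Prop :=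
  ∀ f : Space d → ℂ, MemLp f 2 volume →
    ∑' z : Λ, ‖stft g f z‖ₑ ^ 2 ≤ ENNReal.ofReal B * eLpNorm f 2 volume ^ 2

/-- The Gabor system `{π(z) g | z ∈ Λ}` is a frame of `L²(ℝ^d)`. -/
def IsGaborFrame {d : ℕ} (g : Space d → ℂ) (Λ : Set (Phase d)) : Prop :=
  ∃ A B : ℝ, 0 < A ∧ A ≤ B ∧ IsLowerFrameBound g Λ A ∧ IsUpperFrameBound g Λ B

end GaborOdd

end

/-! ### Symmetric time-frequency shifts, parity, and the Gaussian -/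

noncomputable section

namespace GaborOdd

open Complex

variable {d : ℕ}

/-! Write ρ(z) for the symmetric shift, σ for the symplectic form, φ for the Gaussian and p(k) = Mk.
Under the volume condition 2σ is integer valued on Λ, so the commutation phases of shifts from 2Λ
are trivial. Almost-extremal test functions are sums f = ∑_{k ∈ F} ρ(2p(k))φ over large boxes F. The
coefficients of f are ⟨f, ρ(p(l))g⟩ = ∑_{k ∈ F} χ(k,l) c(l - 2k), with c(m) = ⟨φ, ρ(p(m))g⟩ and χ
unimodular. Since φ is even and g odd, c is odd. The reflection k ↦ l - k negates l - 2k and, by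
integrality of 2σ, preserves χ. Hence the terms with k and l - k both in F cancel
(`sum_eq_sum_boundary`), and since c is in ℓ¹ the total energy is o(|F|)
(`exists_finset_tsum_enorm_sq_sum_le`). On the other hand, all inner products of the summands of f
are positive, so ‖f‖² is at least a constant times |F|. Thus no lower bound A > 0 survives. The
summability of c is where g ∈ S₀ enters: Moyal's identity controls c by averages of V_g g against
Gaussians (`tsum_pairing_symShift_gaussian_ne_top`). -/

@[simp] lemma timePart_add (z w : Phase d) : timePart (z + w) = timePart z + timePart w := rfl
@[simp] lemma freqPart_add (z w : Phase d) : freqPart (z + w) = freqPart z + freqPart w := rfl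
@[simp] lemma timePart_sub (z w : Phase d) : timePart (z - w) = timePart z - timePart w := rfl
@[simp] lemma freqPart_sub (z w : Phase d) : freqPart (z - w) = freqPart z - freqPart w := rfl
@[simp] lemma timePart_neg (z : Phase d) : timePart (-z) = -timePart z := rfl
@[simp] lemma freqPart_neg (z : Phase d) : freqPart (-z) = -freqPart z := rfl

lemma norm_timePart_sq_add_norm_freqPart_sq (z : Phase d) :
    ‖timePart z‖ ^ 2 + ‖freqPart z‖ ^ 2 = ∑ i, z i ^ 2 := by
  simp [EuclideanSpace.norm_sq_eq, timePart, freqPart, Fintype.sum_sum_type]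

/-- The symmetric time-frequency shift `ρ(z) g (t) = e^{2 π i ω · (t - x / 2)} g (t - x)`. -/
def symShift (z : Phase d) (g : Space d → ℂ) (t : Space d) : ℂ :=
  cexp (2 * Real.pi * I *
    (inner ℝ (freqPart z) t - inner ℝ (freqPart z) (timePart z) / 2 : ℝ)) * g (t - timePart z)

/-- The sesquilinear `L²` pairing of functions. -/
def pairing (f h : Space d → ℂ) : ℂ := ∫ t, f t * conj (h t)

/-- The symplectic form `ω · x' - ω' · x` on phase space. -/
def sympForm (z w : Phase d) : ℝ :=
  inner ℝ (freqPart z) (timePart w) - inner ℝ (freqPart w) (timePart z)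

lemma norm_exp_two_pi_mul (r : ℝ) : ‖cexp (2 * Real.pi * I * r)‖ = 1 := by
  rw [show (2 * Real.pi * I * r : ℂ) = ((2 * Real.pi * r : ℝ) : ℂ) * I by push_cast; ring]
  exact norm_exp_ofReal_mul_I _

lemma norm_exp_pi_mul (r : ℝ) : ‖cexp (Real.pi * I * r)‖ = 1 := by
  rw [show (Real.pi * I * r : ℂ) = ((Real.pi * r : ℝ) : ℂ) * I by push_cast; ring]
  exact norm_exp_ofReal_mul_I _

lemma conj_exp_two_pi_mul (r : ℝ) :
    conj (cexp (2 * Real.pi * I * r)) = cexp (2 * Real.pi * I * (-r : ℝ)) := by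
  rw [← exp_conj]; congr 1; simp [conj_ofNat]

lemma conj_exp_pi_mul (r : ℝ) :
    conj (cexp (Real.pi * I * r)) = cexp (Real.pi * I * (-r : ℝ)) := by
  rw [← exp_conj]; congr 1; simp

lemma tfShift_eq_symShift (z : Phase d) (g : Space d → ℂ) (t : Space d) :
    tfShift z g t =
      cexp (Real.pi * I * (inner ℝ (freqPart z) (timePart z) : ℝ)) * symShift z g t := by
  rw [tfShift, symShift, ← mul_assoc, ← exp_add]
  congr 2
  push_cast; ring

lemma stft_eq_pairing (g f : Space d → ℂ) (z : Phase d) :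
    stft g f z = conj (cexp (Real.pi * I * (inner ℝ (freqPart z) (timePart z) : ℝ))) *
      pairing f (symShift z g) := by
  simp only [stft, pairing, ← integral_const_mul]
  congr 1 with t
  rw [tfShift_eq_symShift, map_mul]; ring

lemma norm_stft (g f : Space d → ℂ) (z : Phase d) :
    ‖stft g f z‖ = ‖pairing f (symShift z g)‖ := by
  rw [stft_eq_pairing, norm_mul, RCLike.norm_conj, norm_exp_pi_mul, one_mul]

/-- With the symmetric phase the cocycle depends only on the symplectic form, so integrality of that
form alone governs every phase below. -/
lemma symShift_symShift (z w : Phase d) (g : Space d → ℂ) (t : Space d) :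
    symShift z (symShift w g) t =
      cexp (Real.pi * I * (sympForm z w : ℝ)) * symShift (z + w) g t := by
  simp only [symShift, sympForm, timePart_add, freqPart_add]
  rw [← mul_assoc, ← mul_assoc, ← exp_add, ← exp_add, sub_sub]
  congr 2
  simp only [inner_add_left, inner_add_right, inner_sub_right]
  push_cast; ring

lemma norm_symShift (z : Phase d) (g : Space d → ℂ) (t : Space d) :
    ‖symShift z g t‖ = ‖g (t - timePart z)‖ := by
  rw [symShift, norm_mul, norm_exp_two_pi_mul, one_mul]

lemma aestronglyMeasurable_symShift {g : Space d → ℂ} (hg : AEStronglyMeasurable g volume)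
    (z : Phase d) : AEStronglyMeasurable (symShift z g) volume := by
  refine AEStronglyMeasurable.mul ?_ ?_
  · exact Continuous.aestronglyMeasurable (by fun_prop)
  · exact hg.comp_measurePreserving (measurePreserving_sub_right volume _)

lemma memLp_symShift {g : Space d → ℂ} (hg : MemLp g 2 volume) (z : Phase d) :
    MemLp (symShift z g) 2 volume := by
  have h := hg.comp_measurePreserving (measurePreserving_sub_right volume (timePart z))
  exact (memLp_congr_norm (aestronglyMeasurable_symShift hg.1 z) h.1
    (Filter.Eventually.of_forall fun t => norm_symShift z g t)).2 h

lemma integrable_mul_conj {f h : Space d → ℂ} (hf : MemLp f 2 volume) (hh : MemLp h 2 volume) :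
    Integrable (fun t => f t * conj (h t)) volume :=
  hf.integrable_mul hh.star

lemma pairing_symShift_left (z : Phase d) (f h : Space d → ℂ) :
    pairing (symShift z f) h = pairing f (symShift (-z) h) := by
  rw [pairing, ← integral_add_right_eq_self _ (timePart z), pairing]
  congr 1 with t
  simp only [symShift, add_sub_cancel_right, map_mul, conj_exp_two_pi_mul, timePart_neg,
    freqPart_neg, sub_neg_eq_add]
  rw [show (inner ℝ (freqPart z) (t + timePart z) - inner ℝ (freqPart z) (timePart z) / 2 : ℝ) =
    -(inner ℝ (-freqPart z) t - inner ℝ (-freqPart z) (-timePart z) / 2) by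
      simp only [inner_add_right, inner_neg_left, inner_neg_right]; ring]
  ring

lemma pairing_symShift_symShift (z w : Phase d) (f h : Space d → ℂ) :
    pairing (symShift z f) (symShift w h) =
      cexp (Real.pi * I * (sympForm z w : ℝ)) * pairing f (symShift (w - z) h) := by
  rw [pairing_symShift_left]
  simp only [pairing, symShift_symShift, ← integral_const_mul]
  congr 1 with t
  rw [map_mul, conj_exp_pi_mul, neg_add_eq_sub,
    show -sympForm (-z) w = sympForm z w by
      simp [sympForm, neg_add_eq_sub]]
  ring

lemma conj_pairing (f h : Space d → ℂ) : conj (pairing f h) = pairing h f := by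
  simp only [pairing, ← integral_conj, map_mul, conj_conj, mul_comm]

lemma pairing_sum_left {ι : Type*} (s : Finset ι) (a : ι → Space d → ℂ) {h : Space d → ℂ}
    (ha : ∀ i ∈ s, MemLp (a i) 2 volume) (hh : MemLp h 2 volume) :
    pairing (fun t => ∑ i ∈ s, a i t) h = ∑ i ∈ s, pairing (a i) h := by
  simp only [pairing, Finset.sum_mul]
  exact integral_finsetSum _ fun i hi => integrable_mul_conj (ha i hi) hh

lemma pairing_sum_right {ι : Type*} (s : Finset ι) (a : ι → Space d → ℂ) {h : Space d → ℂ}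
    (ha : ∀ i ∈ s, MemLp (a i) 2 volume) (hh : MemLp h 2 volume) :
    pairing h (fun t => ∑ i ∈ s, a i t) = ∑ i ∈ s, pairing h (a i) := by
  rw [← conj_pairing, pairing_sum_left s a ha hh, map_sum]
  simp only [conj_pairing]

/-- An odd window and an even function pair to an odd function on phase space. -/
lemma pairing_symShift_neg {f g : Space d → ℂ} (hf : ∀ t, f (-t) = f t)
    (hg : ∀ᵐ t ∂(volume : Measure (Space d)), g (-t) = -g t) (z : Phase d) :
    pairing f (symShift (-z) g) = -pairing f (symShift z g) := by
  rw [pairing, ← integral_neg_eq_self, pairing, ← integral_neg]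
  apply integral_congr_ae
  have h := (measurePreserving_sub_right volume (timePart z)).quasiMeasurePreserving.ae hg
  filter_upwards [h] with t ht
  simp only [symShift, timePart_neg, freqPart_neg, sub_neg_eq_add, inner_neg_left,
    inner_neg_right, neg_neg, hf]
  rw [show -t + timePart z = -(t - timePart z) by abel, ht]
  simp

lemma eLpNorm_two_sq (f : Space d → ℂ) (hf : MemLp f 2 volume) :
    eLpNorm f 2 volume ^ 2 = ENNReal.ofReal (pairing f f).re := by
  have h1 : pairing f f = ((∫ t, ‖f t‖ ^ 2 : ℝ) : ℂ) := by
    rw [pairing, ← integral_complex_ofReal]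
    congr 1 with t
    rw [mul_conj, normSq_eq_norm_sq]
  rw [h1, ofReal_re, ofReal_integral_eq_lintegral_ofReal (hf.integrable_norm_pow two_ne_zero)
    (Filter.Eventually.of_forall fun t => by positivity)]
  rw [eLpNorm_eq_lintegral_rpow_enorm_toReal (by norm_num) (by norm_num)]
  simp only [ENNReal.toReal_ofNat, ENNReal.rpow_ofNat]
  rw [← ENNReal.rpow_natCast, ← ENNReal.rpow_mul]
  norm_num

/-- The standard Gaussian. -/
def gaussian (t : Space d) : ℂ := cexp (-Real.pi * ‖t‖ ^ 2)

lemma gaussian_neg (t : Space d) : gaussian (-t) = gaussian t := by simp [gaussian]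

lemma continuous_gaussian : Continuous (gaussian (d := d)) := by
  unfold gaussian; fun_prop

lemma conj_gaussian (t : Space d) : conj (gaussian t) = gaussian t := by
  rw [gaussian, ← exp_conj]; simp

lemma memLp_gaussian : MemLp (gaussian (d := d)) 2 volume := by
  rw [memLp_two_iff_integrable_sq_norm continuous_gaussian.aestronglyMeasurable]
  have h := (GaussianFourier.integrable_cexp_neg_mul_sq_norm_add (V := Space d)
    (b := 2 * Real.pi) (by simp [Real.pi_pos]) 0 0).norm
  refine h.congr (Filter.Eventually.of_forall fun t => ?_)
  simp only [gaussian, zero_mul, add_zero]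
  rw [← norm_pow, ← exp_nat_mul]
  congr 2
  push_cast; ring

/-- The symmetric phase makes this value real and positive; the lower bound on the norm of the test
function rests on that sign. -/
lemma pairing_gaussian_symShift (z : Phase d) :
    pairing gaussian (symShift z gaussian) =
      ((2⁻¹ : ℝ) ^ (d / 2 : ℝ) * Real.exp (-(Real.pi / 2) * ∑ i, z i ^ 2) : ℝ) := by
  -- Centring at x/2 cancels the cross terms of the two Gaussians and the constant phase, leaving
  -- the Fourier transform of exp(-2π|t|²).
  rw [pairing, ← integral_add_right_eq_self _ ((2⁻¹ : ℝ) • timePart z)]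
  have key : ∀ t : Space d, gaussian (t + (2⁻¹ : ℝ) • timePart z) *
      conj (symShift z gaussian (t + (2⁻¹ : ℝ) • timePart z)) =
      cexp (-(Real.pi / 2) * ‖timePart z‖ ^ 2) *
        cexp (-(2 * Real.pi) * ‖t‖ ^ 2 + (-2 * Real.pi * I) * (inner ℝ (freqPart z) t : ℝ)) := by
    intro t
    rw [symShift, map_mul, conj_gaussian, conj_exp_two_pi_mul, gaussian, gaussian, ← exp_add,
      ← exp_add, ← exp_add]
    congr 1
    have h1 : ‖t + (2⁻¹ : ℝ) • timePart z‖ ^ 2 =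
        ‖t‖ ^ 2 + inner ℝ t (timePart z) + ‖timePart z‖ ^ 2 / 4 := by
      rw [norm_add_sq_real, norm_smul, inner_smul_right]; norm_num; ring
    have h2 : ‖t + (2⁻¹ : ℝ) • timePart z - timePart z‖ ^ 2 =
        ‖t‖ ^ 2 - inner ℝ t (timePart z) + ‖timePart z‖ ^ 2 / 4 := by
      rw [show t + (2⁻¹ : ℝ) • timePart z - timePart z = t - (2⁻¹ : ℝ) • timePart z by module,
        norm_sub_sq_real, norm_smul, inner_smul_right]; norm_num; ring
    have h1' := congrArg (fun r : ℝ => (r : ℂ)) h1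
    have h2' := congrArg (fun r : ℝ => (r : ℂ)) h2
    push_cast at h1' h2'
    rw [h1', h2', inner_add_right, inner_smul_right]
    push_cast; ring
  simp_rw [key, integral_const_mul]
  rw [GaussianFourier.integral_cexp_neg_mul_sq_norm_add (by simp [Real.pi_pos]),
    ← norm_timePart_sq_add_norm_freqPart_sq, finrank_euclideanSpace_fin]
  have hp : (Real.pi : ℂ) ≠ 0 := by exact_mod_cast Real.pi_ne_zero
  rw [show (Real.pi : ℂ) / (2 * Real.pi) = ((2⁻¹ : ℝ) : ℂ) by push_cast; field_simp]
  rw [ofReal_mul, ofReal_cpow (by norm_num), mul_left_comm, ofReal_exp, ← exp_add]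
  push_cast
  congr 2
  rw [show (-2 * (Real.pi : ℂ) * I) ^ 2 = -4 * Real.pi ^ 2 by
    rw [mul_pow, mul_pow, I_sq]; ring]
  field_simp
  ring

lemma norm_pairing_symShift_gaussian (z w : Phase d) :
    ‖pairing (symShift z gaussian) (symShift w gaussian)‖ =
      (2⁻¹ : ℝ) ^ (d / 2 : ℝ) * Real.exp (-(Real.pi / 2) * ∑ i, (w i - z i) ^ 2) := by
  rw [pairing_symShift_symShift, norm_mul, norm_exp_pi_mul, one_mul, pairing_gaussian_symShift,
    norm_real, Real.norm_of_nonneg (by positivity)]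
  rfl

end GaborOdd

end

/-! ### Boundary cancellation over integer boxes -/

noncomputable section

namespace GaborOdd

open Filter Topology

/-- The integer box `{0, …, N - 1}^ι`. -/
def intBox (ι : Type*) [Fintype ι] [DecidableEq ι] (N : ℕ) : Finset (ι → ℤ) :=
  Fintype.piFinset fun _ => Finset.Ico 0 (N : ℤ)

lemma card_intBox (ι : Type*) [Fintype ι] [DecidableEq ι] (N : ℕ) :
    (intBox ι N).card = ∏ _i : ι, N := by
  simp [intBox, Fintype.card_piFinset]

/-- Boxes are asymptotically invariant under translations. -/
lemma tendsto_card_boundary_intBox {ι : Type*} [Fintype ι] [DecidableEq ι] (m : ι → ℤ) :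
    Tendsto (fun N : ℕ => ((intBox ι N).filter fun k => k + m ∉ intBox ι N).card /
      ((intBox ι N).card : ℝ)) atTop (𝓝 0) := by
  -- Staying in the box is a coordinatewise condition, so the count is a product of one-dimensional
  -- counts, each at least N - |m i|.
  have hcard : ∀ N : ℕ, ((intBox ι N).filter fun k => k + m ∈ intBox ι N).card =
      ∏ i, ((Finset.Ico 0 (N : ℤ)).filter fun a => a + m i ∈ Finset.Ico 0 (N : ℤ)).card := by
    intro N
    rw [← Fintype.card_piFinset]
    congr 1
    ext k
    simp only [intBox, Finset.mem_filter, Fintype.mem_piFinset, Pi.add_apply]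
    exact forall_and.symm
  have hfac : ∀ i, Tendsto (fun N : ℕ =>
      (((Finset.Ico 0 (N : ℤ)).filter fun a => a + m i ∈ Finset.Ico 0 (N : ℤ)).card : ℝ) / N)
      atTop (𝓝 1) := by
    intro i
    have hlow : Tendsto (fun N : ℕ => 1 - |(m i : ℝ)| / N) atTop (𝓝 1) := by
      simpa using (tendsto_const_div_atTop_nhds_zero_nat (|(m i : ℝ)|)).const_sub 1
    refine tendsto_of_tendsto_of_tendsto_of_le_of_le' hlow tendsto_const_nhds ?_ ?_
    · filter_upwards [eventually_gt_atTop 0] with N hN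
      have hN' : (0 : ℝ) < N := by exact_mod_cast hN
      rw [le_div_iff₀ hN', sub_mul, div_mul_cancel₀ _ hN'.ne', one_mul]
      have hsub : Finset.Ico (max 0 (-m i)) (min N (N - m i)) ⊆
          (Finset.Ico 0 (N : ℤ)).filter fun a => a + m i ∈ Finset.Ico 0 (N : ℤ) := by
        intro a ha
        simp only [Finset.mem_Ico, Finset.mem_filter] at ha ⊢
        omega
      have h1 := Finset.card_le_card hsub
      rw [Int.card_Ico] at h1
      have h2 : (N : ℤ) - |m i| ≤
          ((Finset.Ico 0 (N : ℤ)).filter fun a => a + m i ∈ Finset.Ico 0 (N : ℤ)).card := by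
        rcases abs_cases (m i) with h | h <;> omega
      exact_mod_cast h2
    · filter_upwards with N
      refine div_le_one_of_le₀ ?_ (Nat.cast_nonneg _)
      exact_mod_cast (Finset.card_filter_le _ _).trans (by simp)
  have hprod := tendsto_finsetProd Finset.univ fun i _ => hfac i
  rw [Finset.prod_const_one] at hprod
  have hone := hprod.const_sub 1
  rw [sub_self] at hone
  refine hone.congr' ?_
  filter_upwards [eventually_gt_atTop 0] with N hN
  have hN' : ((intBox ι N).card : ℝ) ≠ 0 := by
    rw [card_intBox]
    simp [hN.ne']
  have hsplit := Finset.card_filter_add_card_filter_not (s := intBox ι N)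
    (fun k => k + m ∈ intBox ι N)
  rw [Finset.prod_div_distrib, eq_div_iff hN', sub_mul, one_mul,
    show ∏ _i : ι, (N : ℝ) = ((intBox ι N).card : ℝ) by rw [card_intBox]; push_cast; rfl,
    div_mul_cancel₀ _ hN', ← Nat.cast_prod, ← hcard, ← hsplit]
  push_cast; ring

/-- If the terms of a summable odd family are distributed along `l - 2 k` with unimodular factors
that respect the reflection `k ↦ l - k`, then only boundary terms survive in each sum over `F`. -/
lemma sum_eq_sum_boundary {ι : Type*} (F : Finset (ι → ℤ)) [DecidableEq (ι → ℤ)]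
    (c : (ι → ℤ) → ℂ) (hc : ∀ m, c (-m) = -c m) (χ : (ι → ℤ) → (ι → ℤ) → ℂ)
    (hχ : ∀ k l, χ (l - k) l = χ k l) (l : ι → ℤ) :
    ∑ k ∈ F, χ k l * c (l - (k + k)) =
      ∑ k ∈ F.filter (fun k => l - k ∉ F), χ k l * c (l - (k + k)) := by
  rw [← Finset.sum_filter_add_sum_filter_not F (fun k => l - k ∈ F), add_eq_right]
  set S := ∑ k ∈ F.filter (fun k => l - k ∈ F), χ k l * c (l - (k + k)) with hS
  have h : S = -S := by
    rw [hS, ← Finset.sum_neg_distrib]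
    refine Finset.sum_nbij' (fun k => l - k) (fun k => l - k) ?_ ?_ ?_ ?_ ?_
    · intro k hk
      simp only [Finset.mem_filter, sub_sub_cancel] at hk ⊢
      exact hk.symm
    · intro k hk
      simp only [Finset.mem_filter, sub_sub_cancel] at hk ⊢
      exact hk.symm
    · intro k _; exact sub_sub_cancel _ _
    · intro k _; exact sub_sub_cancel _ _
    · intro k _
      rw [hχ, show l - (l - k + (l - k)) = -(l - (k + k)) by abel, hc]
      ring
  exact self_eq_neg.1 h

/-- One factor of each square is bounded by the ℓ¹ norm of c (k ↦ l - 2k is injective), the other by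
its boundary terms. Exchanging sums and putting l = m + 2k turns l - k ∉ F into k + m ∉ F. -/
lemma tsum_enorm_sq_sum_le {ι : Type*} [DecidableEq (ι → ℤ)] (F : Finset (ι → ℤ))
    (c : (ι → ℤ) → ℂ) (hc : ∀ m, c (-m) = -c m) (χ : (ι → ℤ) → (ι → ℤ) → ℂ)
    (hχ : ∀ k l, χ (l - k) l = χ k l) (hχ1 : ∀ k l, ‖χ k l‖ = 1) :
    ∑' l, ‖∑ k ∈ F, χ k l * c (l - (k + k))‖ₑ ^ 2 ≤
      (∑' m, ‖c m‖ₑ) * ∑' m, ‖c m‖ₑ * ((F.filter fun k => k + m ∉ F).card : ℝ≥0∞) := by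
  have hterm : ∀ k l, ‖χ k l * c (l - (k + k))‖ₑ = ‖c (l - (k + k))‖ₑ := by
    intro k l
    rw [enorm_mul, ← ofReal_norm (χ k l), hχ1, ENNReal.ofReal_one, one_mul]
  have hsup : ∀ l, ‖∑ k ∈ F, χ k l * c (l - (k + k))‖ₑ ≤ ∑' m, ‖c m‖ₑ := by
    intro l
    have hinj : Function.Injective fun k : ι → ℤ => l - (k + k) := by
      intro k k' h
      funext i
      have := congrFun h i
      simp only [Pi.sub_apply, Pi.add_apply] at this
      omega
    calc _ ≤ ∑ k ∈ F, ‖c (l - (k + k))‖ₑ := by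
          refine (enorm_sum_le _ _).trans_eq ?_
          simp only [hterm]
      _ ≤ ∑' k, ‖c (l - (k + k))‖ₑ := ENNReal.sum_le_tsum _
      _ ≤ _ := ENNReal.tsum_comp_le_tsum_of_injective hinj _
  have hbd : ∀ l, ‖∑ k ∈ F, χ k l * c (l - (k + k))‖ₑ ≤
      ∑ k ∈ F, if l - k ∉ F then ‖c (l - (k + k))‖ₑ else 0 := by
    intro l
    rw [sum_eq_sum_boundary F c hc χ hχ, ← Finset.sum_filter]
    refine (enorm_sum_le _ _).trans_eq ?_
    simp only [hterm]
  calc _ ≤ ∑' l, (∑' m, ‖c m‖ₑ) * ∑ k ∈ F, if l - k ∉ F then ‖c (l - (k + k))‖ₑ else 0 := by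
        refine ENNReal.tsum_le_tsum fun l => ?_
        rw [sq]
        exact mul_le_mul' (hsup l) (hbd l)
    _ = (∑' m, ‖c m‖ₑ) * ∑ k ∈ F, ∑' l, if l - k ∉ F then ‖c (l - (k + k))‖ₑ else 0 := by
        rw [ENNReal.tsum_mul_left, Summable.tsum_finsetSum fun _ _ => ENNReal.summable]
    _ = (∑' m, ‖c m‖ₑ) * ∑ k ∈ F, ∑' m, if k + m ∉ F then ‖c m‖ₑ else 0 := by
        congr 1
        refine Finset.sum_congr rfl fun k _ => ?_
        rw [← (Equiv.addRight (k + k)).tsum_eq]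
        refine tsum_congr fun m => ?_
        simp only [Equiv.coe_addRight, add_sub_cancel_right]
        rw [show m + (k + k) - k = k + m by abel]
    _ = _ := by
        rw [← Summable.tsum_finsetSum fun _ _ => ENNReal.summable]
        congr 1
        refine tsum_congr fun m => ?_
        rw [← Finset.sum_filter, Finset.sum_const, nsmul_eq_mul, mul_comm]

/-- The averaged energy of the sums over large boxes tends to zero. -/
lemma exists_finset_tsum_enorm_sq_sum_le {ι : Type*} [Fintype ι] [DecidableEq ι]
    (c : (ι → ℤ) → ℂ) (hsum : Summable fun m => ‖c m‖) (hc : ∀ m, c (-m) = -c m)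
    (χ : (ι → ℤ) → (ι → ℤ) → ℂ) (hχ : ∀ k l, χ (l - k) l = χ k l) (hχ1 : ∀ k l, ‖χ k l‖ = 1)
    {ε : ℝ} (hε : 0 < ε) :
    ∃ F : Finset (ι → ℤ), F.Nonempty ∧
      ∑' l, ‖∑ k ∈ F, χ k l * c (l - (k + k))‖ₑ ^ 2 ≤ ENNReal.ofReal (ε * F.card) := by
  -- Dominated convergence: the boundary fraction is at most 1 and vanishes in the limit for each
  -- fixed m.
  have hT : Tendsto (fun N : ℕ => ∑' m, ‖c m‖ * (((intBox ι N).filter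
      fun k => k + m ∉ intBox ι N).card / ((intBox ι N).card : ℝ))) atTop (𝓝 0) := by
    have h0 : (0 : ℝ) = ∑' m : ι → ℤ, ‖c m‖ * 0 := by simp only [mul_zero, tsum_zero]
    rw [h0]
    refine tendsto_tsum_of_dominated_convergence hsum
      (fun m => (tendsto_card_boundary_intBox m).const_mul _) (Eventually.of_forall fun N m => ?_)
    rw [norm_mul, norm_norm, Real.norm_of_nonneg (div_nonneg (Nat.cast_nonneg _) (Nat.cast_nonneg _))]
    refine mul_le_of_le_one_right (norm_nonneg _) (div_le_one_of_le₀ ?_ (Nat.cast_nonneg _))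
    exact_mod_cast Finset.card_filter_le _ _
  have hT' := hT.const_mul (∑' m, ‖c m‖)
  rw [mul_zero] at hT'
  obtain ⟨N, hNε, hN⟩ := ((hT'.eventually_lt_const hε).and (eventually_gt_atTop 0)).exists
  have hcard : 0 < (intBox ι N).card := by
    rw [card_intBox]
    exact Finset.prod_pos fun _ _ => hN
  refine ⟨intBox ι N, Finset.card_pos.1 hcard, ?_⟩
  have hcard' : (0 : ℝ) < (intBox ι N).card := by exact_mod_cast hcard
  refine (tsum_enorm_sq_sum_le (intBox ι N) c hc χ hχ hχ1).trans ?_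
  have hs2 : Summable fun m => ‖c m‖ *
      (((intBox ι N).filter fun k => k + m ∉ intBox ι N).card : ℝ) := by
    refine Summable.of_nonneg_of_le (fun m => by positivity) (fun m => ?_)
      (hsum.mul_right ((intBox ι N).card : ℝ))
    gcongr
    exact Finset.filter_subset _ _
  have e1 : ∑' m, ‖c m‖ₑ = ENNReal.ofReal (∑' m, ‖c m‖) := by
    rw [ENNReal.ofReal_tsum_of_nonneg (fun _ => norm_nonneg _) hsum]
    simp only [ofReal_norm]
  have e2 : ∑' m, ‖c m‖ₑ * (((intBox ι N).filter fun k => k + m ∉ intBox ι N).card : ℝ≥0∞) =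
      ENNReal.ofReal (∑' m, ‖c m‖ *
        (((intBox ι N).filter fun k => k + m ∉ intBox ι N).card : ℝ)) := by
    rw [ENNReal.ofReal_tsum_of_nonneg (fun _ => by positivity) hs2]
    simp only [ENNReal.ofReal_mul (norm_nonneg _), ofReal_norm, ENNReal.ofReal_natCast]
  rw [e1, e2, ← ENNReal.ofReal_mul (tsum_nonneg fun _ => norm_nonneg _)]
  refine ENNReal.ofReal_le_ofReal ?_
  simp only [← mul_div_assoc, tsum_div_const] at hNε
  rw [div_lt_iff₀ hcard'] at hNε
  exact hNε.le

end GaborOdd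

end

/-! ### Uniform bounds for Gaussian sums over lattices -/

noncomputable section

namespace GaborOdd

/-- Every finite set of indices lies in a product of finite sets, over which the sum factorises. -/
lemma summable_pi_prod {ι κ : Type*} [Fintype ι] (f : κ → ℝ)
    (hf0 : ∀ a, 0 ≤ f a) (hf : Summable f) : Summable fun m : ι → κ => ∏ i, f (m i) := by
  classical
  refine summable_of_sum_le (c := ∏ _i : ι, ∑' a, f a)
    (fun m => Finset.prod_nonneg fun i _ => hf0 _) fun s => ?_
  calc ∑ m ∈ s, ∏ i, f (m i)
      ≤ ∑ m ∈ Fintype.piFinset fun i => s.image fun m => m i, ∏ i, f (m i) := by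
        refine Finset.sum_le_sum_of_subset_of_nonneg (fun m hm => ?_)
          fun m _ _ => Finset.prod_nonneg fun i _ => hf0 _
        rw [Fintype.mem_piFinset]
        exact fun i => Finset.mem_image_of_mem _ hm
    _ = ∏ i, ∑ a ∈ s.image fun m => m i, f a := (Finset.prod_univ_sum _ _).symm
    _ ≤ _ := Finset.prod_le_prod (fun i _ => Finset.sum_nonneg fun a _ => hf0 a)
        fun i _ => hf.sum_le_tsum _ fun a _ => hf0 a

lemma summable_int_exp_neg_mul_sq {b : ℝ} (hb : 0 < b) :
    Summable fun m : ℤ => Real.exp (-b * (m : ℝ) ^ 2) := by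
  have hnat : Summable fun n : ℕ => Real.exp (-b * (n : ℝ) ^ 2) := by
    refine Summable.of_nonneg_of_le (fun _ => (Real.exp_pos _).le) (fun n => ?_)
      (Real.summable_exp_nat_mul_iff.2 (neg_lt_zero.2 hb))
    refine Real.exp_le_exp.2 ?_
    have h : (n : ℝ) ≤ (n : ℝ) ^ 2 := by exact_mod_cast Nat.le_self_pow two_ne_zero n
    nlinarith
  refine Summable.of_nat_of_neg (by simpa using hnat) (by simpa using hnat)

/-- Sums of a Gaussian over translates of the integer lattice are uniformly bounded. -/
lemma exists_tsum_gaussian_sub_le {ι : Type*} [Fintype ι] {a : ℝ} (ha : 0 < a) :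
    ∃ C : ℝ≥0∞, C ≠ ∞ ∧ ∀ y : ι → ℝ,
      ∑' k : ι → ℤ, ENNReal.ofReal (Real.exp (-a * ∑ i, ((k i : ℝ) - y i) ^ 2)) ≤ C := by
  -- A majorant independent of y: with r ∈ [0,1) the fractional part of y i, m²/2 ≤ (m - r)² + 1,
  -- which costs a factor exp a and half the exponent.
  set f : ℤ → ℝ := fun m => Real.exp a * Real.exp (-(a / 2) * (m : ℝ) ^ 2) with hf
  have hf0 : ∀ m, 0 ≤ f m := fun m => by positivity
  have hs : Summable fun m : ι → ℤ => ∏ i, f (m i) :=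
    summable_pi_prod f hf0 ((summable_int_exp_neg_mul_sq (half_pos ha)).mul_left _)
  refine ⟨∑' m : ι → ℤ, ENNReal.ofReal (∏ i, f (m i)), hs.tsum_ofReal_ne_top, fun y => ?_⟩
  rw [← (Equiv.addRight fun i => ⌊y i⌋).tsum_eq]
  refine ENNReal.tsum_le_tsum fun m => ENNReal.ofReal_le_ofReal ?_
  rw [Finset.mul_sum, Real.exp_sum]
  refine Finset.prod_le_prod (fun i _ => (Real.exp_pos _).le) fun i _ => ?_
  simp only [hf]
  rw [← Real.exp_add]
  refine Real.exp_le_exp.2 ?_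
  simp only [Equiv.coe_addRight, Pi.add_apply, Int.cast_add]
  have h1 := Int.floor_le (y i)
  have h2 := Int.lt_floor_add_one (y i)
  set r := y i - ⌊y i⌋ with hr
  rw [show (m i : ℝ) + ⌊y i⌋ - y i = m i - r by rw [hr]; ring]
  have hr0 : 0 ≤ r := by linarith
  have hr1 : r ≤ 1 := by linarith
  have hkey : (m i : ℝ) ^ 2 / 2 ≤ ((m i : ℝ) - r) ^ 2 + 1 := by
    nlinarith [sq_nonneg ((m i : ℝ) - 2 * r)]
  nlinarith

/-- Apply Cauchy–Schwarz to each row of v = M⁻¹(Mv). This reduces a general lattice to ℤⁿ. -/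
lemma exists_pos_mul_sum_sq_le {ι : Type*} [Fintype ι] [DecidableEq ι] {M : Matrix ι ι ℝ}
    (hM : IsUnit M.det) : ∃ δ : ℝ, 0 < δ ∧ ∀ v : ι → ℝ, δ * ∑ i, v i ^ 2 ≤ ∑ i, (M *ᵥ v) i ^ 2 := by
  set C : ℝ := ∑ i, ∑ j, M⁻¹ i j ^ 2 with hC
  have hC0 : 0 ≤ C := Finset.sum_nonneg fun i _ => Finset.sum_nonneg fun j _ => sq_nonneg _
  refine ⟨(C + 1)⁻¹, by positivity, fun v => ?_⟩
  rw [inv_mul_le_iff₀ (by positivity)]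
  have hv : v = M⁻¹ *ᵥ (M *ᵥ v) := by
    rw [Matrix.mulVec_mulVec, Matrix.nonsing_inv_mul _ hM, Matrix.one_mulVec]
  have h1 : ∑ i, v i ^ 2 ≤ C * ∑ i, (M *ᵥ v) i ^ 2 := by
    rw [hC, Finset.sum_mul]
    refine Finset.sum_le_sum fun i _ => ?_
    conv_lhs => rw [hv]
    exact Finset.sum_mul_sq_le_sq_mul_sq _ _ _
  have h2 : 0 ≤ ∑ i, (M *ᵥ v) i ^ 2 := Finset.sum_nonneg fun i _ => sq_nonneg _
  linarith

/-- Sums of a Gaussian over translates of a lattice are uniformly bounded. -/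
lemma exists_tsum_gaussian_mulVec_sub_le {ι : Type*} [Fintype ι] [DecidableEq ι]
    {M : Matrix ι ι ℝ} (hM : IsUnit M.det) {a : ℝ} (ha : 0 < a) :
    ∃ C : ℝ≥0∞, C ≠ ∞ ∧ ∀ y : ι → ℝ, ∑' k : ι → ℤ, ENNReal.ofReal
      (Real.exp (-a * ∑ i, ((M *ᵥ fun j => (k j : ℝ)) i - y i) ^ 2)) ≤ C := by
  obtain ⟨δ, hδ, hle⟩ := exists_pos_mul_sum_sq_le hM
  obtain ⟨C, hC, hbd⟩ := exists_tsum_gaussian_sub_le (ι := ι) (mul_pos ha hδ)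
  refine ⟨C, hC, fun y => le_trans (ENNReal.tsum_le_tsum fun k => ?_) (hbd (M⁻¹ *ᵥ y))⟩
  refine ENNReal.ofReal_le_ofReal (Real.exp_le_exp.2 ?_)
  have h := hle ((fun j => (k j : ℝ)) - M⁻¹ *ᵥ y)
  rw [Matrix.mulVec_sub, Matrix.mulVec_mulVec, Matrix.mul_nonsing_inv _ hM,
    Matrix.one_mulVec] at h
  simp only [Pi.sub_apply] at h
  nlinarith

end GaborOdd

end

/-! ### Moyal's identity and summability for windows in S₀ -/

noncomputable section

namespace GaborOdd

open Complex
open scoped FourierTransform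

variable {d : ℕ}

/-- The point `(x, ω)` of phase space. -/
def phaseMk (p : Space d × Space d) : Phase d := Sum.elim p.1.ofLp p.2.ofLp

@[simp] lemma timePart_phaseMk (p : Space d × Space d) : timePart (phaseMk p) = p.1 := rfl
@[simp] lemma freqPart_phaseMk (p : Space d × Space d) : freqPart (phaseMk p) = p.2 := rfl

lemma continuous_timePart : Continuous (timePart (d := d)) := by
  unfold timePart; fun_prop

lemma continuous_freqPart : Continuous (freqPart (d := d)) := by
  unfold freqPart; fun_prop

lemma continuous_phaseMk : Continuous (phaseMk (d := d)) := by
  refine continuous_pi fun i => ?_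
  cases i <;> simp only [phaseMk, Sum.elim_inl, Sum.elim_inr] <;> fun_prop

lemma measurePreserving_phaseMk :
    MeasurePreserving (phaseMk (d := d)) (volume.prod volume) volume := by
  have h1 : MeasurePreserving (Prod.map (@WithLp.ofLp 2 (Fin d → ℝ)) (@WithLp.ofLp 2 (Fin d → ℝ)))
      (volume.prod volume) (volume.prod volume) :=
    (PiLp.volume_preserving_ofLp (Fin d)).prod (PiLp.volume_preserving_ofLp (Fin d))
  have h2 := (volume_measurePreserving_sumPiEquivProdPi_symm (fun _ : Fin d ⊕ Fin d => ℝ)).comp h1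
  convert h2 using 1
  ext p i
  cases i <;> rfl

lemma integral_phase {F : Phase d → ℂ} (hF : Integrable F) :
    ∫ z, F z = ∫ x, ∫ ω, F (phaseMk (x, ω)) := by
  rw [← measurePreserving_phaseMk.map_eq,
    integral_map measurePreserving_phaseMk.aemeasurable
      (by rw [measurePreserving_phaseMk.map_eq]; exact hF.1)]
  exact integral_prod _ (measurePreserving_phaseMk.integrable_comp_of_integrable hF)

lemma stft_eq_fourier (g f : Space d → ℂ) (z : Phase d) :
    stft g f z = 𝓕 (fun t => f t * conj (g (t - timePart z))) (freqPart z) := by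
  rw [stft, Real.fourier_eq']
  congr 1 with t
  rw [tfShift, map_mul, conj_exp_two_pi_mul, real_inner_comm, smul_eq_mul,
    show (2 * Real.pi * I * (-inner ℝ t (freqPart z) : ℝ) : ℂ) =
      (-2 * Real.pi * inner ℝ t (freqPart z) : ℝ) * I by push_cast; ring]
  ring

/-- Parseval by moving the transform from K onto 𝓕 G and inverting. K is only assumed integrable,
because products of two L² functions are inserted for it. -/
lemma integral_fourier_mul_conj {K G : Space d → ℂ} (hK : Integrable K) (hG : Integrable G)
    (hGc : Continuous G) (hFG : Integrable (𝓕 G)) :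
    ∫ ω, 𝓕 G ω * conj (𝓕 K ω) = ∫ t, G t * conj (K t) := by
  have h := VectorFourier.integral_sesq_fourierIntegral_eq_neg_flip (innerSL ℂ (E := ℂ))
    (L := innerₗ (Space d)) Real.continuous_fourierChar continuous_inner hK hFG
  have hinv := hGc.fourierInv_fourier_eq hG hFG
  have h2 : VectorFourier.fourierIntegral Real.fourierChar volume (-(innerₗ (Space d)).flip) (𝓕 G)
      = G := by
    conv_rhs => rw [← hinv]
    ext v
    rw [Real.fourierInv_eq]
    simp [VectorFourier.fourierIntegral]
  rw [h2] at h
  simpa [innerSL_apply_apply, RCLike.inner_apply] using! h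

/-- Moyal's orthogonality relation, for a window with integrable ambiguity function tested against
continuous functions with bounded and partially integrable short-time Fourier transform. -/
lemma integral_stft_mul_conj_stft {g g₁ h : Space d → ℂ} (hg : MemFeichtinger g)
    (hg₁ : MemLp g₁ 2 volume) (hh : MemLp h 2 volume) (hg₁c : Continuous g₁) (hhc : Continuous h)
    (hcont : Continuous (stft g₁ h)) {C : ℝ} (hC : ∀ z, ‖stft g₁ h z‖ ≤ C)
    (hint : ∀ x, Integrable fun ω => stft g₁ h (phaseMk (x, ω))) :
    ∫ z, stft g₁ h z * conj (stft g g z) = pairing h g * pairing g g₁ := by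
  have hshift : ∀ {f : Space d → ℂ} (x : Space d), MemLp f 2 volume →
      MemLp (fun t => f (t - x)) 2 volume := fun x hf =>
    hf.comp_measurePreserving (measurePreserving_sub_right volume x)
  have hF : Integrable fun z => stft g₁ h z * conj (stft g g z) := by
    refine Integrable.bdd_mul (c := C) ?_ hcont.aestronglyMeasurable
      (Filter.Eventually.of_forall hC)
    exact (LinearIsometryEquiv.integrable_comp_iff conjLIE).2 hg.2
  rw [integral_phase hF]
  -- For fixed x both factors are Fourier transforms in ω. After Parseval the result is written as a
  -- convolution at x, whose integral is a product of integrals.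
  have hx : ∀ x : Space d, ∫ ω, stft g₁ h (phaseMk (x, ω)) * conj (stft g g (phaseMk (x, ω))) =
      ∫ t, (h t * conj (g t)) * (g (-(x - t)) * conj (g₁ (-(x - t)))) := by
    intro x
    have hi := hint x
    simp only [stft_eq_fourier, timePart_phaseMk, freqPart_phaseMk] at hi ⊢
    rw [integral_fourier_mul_conj (integrable_mul_conj hg.1 (hshift x hg.1))
      (integrable_mul_conj hh (hshift x hg₁)) (by fun_prop) hi]
    congr 1 with t
    rw [map_mul, conj_conj, neg_sub]
    ring
  simp_rw [hx]
  have hconv := integral_convolution (μ := volume) (ν := volume) (ContinuousLinearMap.mul ℂ ℂ)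
    (integrable_mul_conj hh hg.1) (integrable_mul_conj hg.1 hg₁).comp_neg
  simp only [convolution, ContinuousLinearMap.mul_apply'] at hconv
  rw [hconv, integral_neg_eq_self (fun t => g t * conj (g₁ t))]
  rfl

lemma continuous_symShift_gaussian (z : Phase d) : Continuous (symShift z gaussian) := by
  have := continuous_gaussian (d := d)
  unfold symShift
  fun_prop

lemma stft_symShift_gaussian (u w z : Phase d) :
    stft (symShift u gaussian) (symShift w gaussian) z =
      conj (cexp (Real.pi * I * (inner ℝ (freqPart z) (timePart z) : ℝ))) *
      (conj (cexp (Real.pi * I * (sympForm z u : ℝ))) *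
        pairing (symShift w gaussian) (symShift (z + u) gaussian)) := by
  rw [stft_eq_pairing]
  congr 1
  simp only [pairing, symShift_symShift, ← integral_const_mul]
  congr 1 with t
  rw [map_mul]; ring

lemma norm_stft_symShift_gaussian (u w z : Phase d) :
    ‖stft (symShift u gaussian) (symShift w gaussian) z‖ =
      (2⁻¹ : ℝ) ^ (d / 2 : ℝ) * Real.exp (-(Real.pi / 2) * ∑ i, (z i + u i - w i) ^ 2) := by
  rw [stft_symShift_gaussian, norm_mul, norm_mul, RCLike.norm_conj, RCLike.norm_conj,
    norm_exp_pi_mul, norm_exp_pi_mul, one_mul, one_mul, norm_pairing_symShift_gaussian]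
  rfl

lemma continuous_stft_symShift_gaussian (u w : Phase d) :
    Continuous (stft (symShift u gaussian) (symShift w gaussian)) := by
  have h1 := continuous_timePart (d := d)
  have h2 := continuous_freqPart (d := d)
  simp only [funext (stft_symShift_gaussian u w), pairing_symShift_symShift,
    pairing_gaussian_symShift, sympForm, Pi.sub_apply, Pi.add_apply]
  fun_prop

lemma integrable_stft_symShift_gaussian (u w : Phase d) (x : Space d) :
    Integrable fun ω => stft (symShift u gaussian) (symShift w gaussian) (phaseMk (x, ω)) := by
  have hG := (GaussianFourier.integrable_cexp_neg_mul_sq_norm_add (V := Space d)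
    (b := Real.pi / 2) (by simp [Real.pi_pos]) 0 0).norm.comp_add_right (freqPart u - freqPart w)
  refine Integrable.mono' (hG.const_mul ((2⁻¹ : ℝ) ^ (d / 2 : ℝ)))
    ((continuous_stft_symShift_gaussian u w).comp
      (continuous_phaseMk.comp (by fun_prop))).aestronglyMeasurable
    (Filter.Eventually.of_forall fun ω => ?_)
  rw [norm_stft_symShift_gaussian]
  refine mul_le_mul_of_nonneg_left ?_ (by positivity)
  rw [norm_exp]
  refine Real.exp_le_exp.2 ?_
  have hs := norm_timePart_sq_add_norm_freqPart_sq (phaseMk (x, ω) + u - w)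
  simp only [Pi.sub_apply, Pi.add_apply, freqPart_sub, freqPart_add, freqPart_phaseMk] at hs
  rw [← hs, add_sub_assoc ω]
  have hre : ∀ r : ℝ, (-((Real.pi : ℂ) / 2) * (r : ℂ) ^ 2).re = -(Real.pi / 2) * r ^ 2 := by
    intro r
    rw [← ofReal_re (-(Real.pi / 2) * r ^ 2)]
    push_cast; rfl
  simp only [zero_mul, add_zero, hre]
  have := sq_nonneg ‖timePart (phaseMk (x, ω) + u - w)‖
  nlinarith [Real.pi_pos]

/-- The pairings of a function in Feichtinger's algebra with the lattice shifts of the Gaussian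
are absolutely summable. -/
lemma tsum_pairing_symShift_gaussian_ne_top {g : Space d → ℂ} (hg : MemFeichtinger g)
    {M : Matrix (Fin d ⊕ Fin d) (Fin d ⊕ Fin d) ℝ} (hM : IsUnit M.det) :
    ∑' k : Fin d ⊕ Fin d → ℤ, ‖pairing (symShift (M *ᵥ fun i => (k i : ℝ)) gaussian) g‖ₑ ≠ ∞ := by
  by_cases h0 : ∀ u, pairing g (symShift u gaussian) = 0
  · have hz : ∀ u, pairing (symShift u gaussian) g = 0 := fun u => by
      rw [← conj_pairing, h0, map_zero]
    simp [hz]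
  push Not at h0
  -- This nonzero pairing is the factor divided out of Moyal's identity at the end.
  obtain ⟨u, hu⟩ := h0
  obtain ⟨C, hC, hbd⟩ := exists_tsum_gaussian_mulVec_sub_le hM (half_pos Real.pi_pos)
  set κ : ℝ := (2⁻¹ : ℝ) ^ (d / 2 : ℝ) with hκ
  have hκ0 : 0 ≤ κ := by positivity
  -- The bound is Gaussian in w - (z + u), so its sum over lattice points w is bounded uniformly in
  -- z and only the integral of |V_g g| remains.
  have hterm : ∀ w : Phase d, ‖pairing (symShift w gaussian) g‖ₑ *
      ‖pairing g (symShift u gaussian)‖ₑ ≤ ∫⁻ z, ENNReal.ofReal κ * ‖stft g g z‖ₑ *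
        ENNReal.ofReal (Real.exp (-(Real.pi / 2) * ∑ i, (w i - (z + u) i) ^ 2)) := by
    intro w
    rw [← enorm_mul, ← integral_stft_mul_conj_stft hg (memLp_symShift memLp_gaussian u)
      (memLp_symShift memLp_gaussian w) (continuous_symShift_gaussian u)
      (continuous_symShift_gaussian w) (continuous_stft_symShift_gaussian u w) (C := κ) ?_
      (integrable_stft_symShift_gaussian u w)]
    · refine (enorm_integral_le_lintegral_enorm _).trans_eq (lintegral_congr fun z => ?_)
      rw [enorm_mul, ← ofReal_norm, norm_stft_symShift_gaussian, ENNReal.ofReal_mul hκ0,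
        RCLike.enorm_conj]
      simp only [Pi.add_apply, sub_sq_comm (w _)]
      ring
    · intro z
      rw [norm_stft_symShift_gaussian]
      refine mul_le_of_le_one_right hκ0 (Real.exp_le_one_iff.2 ?_)
      have : 0 ≤ ∑ i, (z i + u i - w i) ^ 2 := Finset.sum_nonneg fun i _ => sq_nonneg _
      nlinarith [Real.pi_pos]
  have hmul : (∑' k : Fin d ⊕ Fin d → ℤ,
      ‖pairing (symShift (M *ᵥ fun i => (k i : ℝ)) gaussian) g‖ₑ) *
      ‖pairing g (symShift u gaussian)‖ₑ ≤ ENNReal.ofReal κ * (∫⁻ z, ‖stft g g z‖ₑ) * C := by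
    rw [← ENNReal.tsum_mul_right]
    refine (ENNReal.tsum_le_tsum fun k => hterm _).trans ?_
    rw [← lintegral_tsum]
    · simp only [ENNReal.tsum_mul_left]
      refine (lintegral_mono fun z => mul_le_mul_right (hbd (z + u)) _).trans_eq ?_
      rw [lintegral_mul_const' _ _ hC, lintegral_const_mul' _ _ ENNReal.ofReal_ne_top]
    · intro k
      refine AEMeasurable.mul (hg.2.1.enorm.const_mul _) (Continuous.aemeasurable ?_)
      simp only [Pi.add_apply]
      exact ENNReal.continuous_ofReal.comp (by fun_prop)
  have hfin : ENNReal.ofReal κ * (∫⁻ z, ‖stft g g z‖ₑ) * C ≠ ∞ :=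
    ENNReal.mul_ne_top (ENNReal.mul_ne_top ENNReal.ofReal_ne_top hg.2.2.ne) hC
  intro htop
  rw [htop, ENNReal.top_mul (by simpa using hu)] at hmul
  exact hfin (top_le_iff.1 hmul)

end GaborOdd

end

/-! ### Half-integral symplectic form and the lower frame bound -/

noncomputable section

namespace GaborOdd

open Complex

variable {d : ℕ}

/-- The lattice point `M k`. -/
def latticePoint (M : Matrix (Fin d ⊕ Fin d) (Fin d ⊕ Fin d) ℝ) (k : Fin d ⊕ Fin d → ℤ) :
    Phase d :=
  M *ᵥ fun i => (k i : ℝ)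

lemma latticePoint_add (M : Matrix (Fin d ⊕ Fin d) (Fin d ⊕ Fin d) ℝ)
    (k l : Fin d ⊕ Fin d → ℤ) :
    latticePoint M (k + l) = latticePoint M k + latticePoint M l := by
  rw [latticePoint, latticePoint, latticePoint, ← Matrix.mulVec_add]
  congr 1; ext i; simp

lemma latticePoint_neg (M : Matrix (Fin d ⊕ Fin d) (Fin d ⊕ Fin d) ℝ)
    (k : Fin d ⊕ Fin d → ℤ) : latticePoint M (-k) = -latticePoint M k := by
  rw [latticePoint, latticePoint, ← Matrix.mulVec_neg]
  congr 1; ext i; simp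

lemma latticePoint_sub (M : Matrix (Fin d ⊕ Fin d) (Fin d ⊕ Fin d) ℝ)
    (k l : Fin d ⊕ Fin d → ℤ) :
    latticePoint M (k - l) = latticePoint M k - latticePoint M l := by
  rw [sub_eq_add_neg, latticePoint_add, latticePoint_neg, sub_eq_add_neg]

lemma latticePoint_injective {M : Matrix (Fin d ⊕ Fin d) (Fin d ⊕ Fin d) ℝ}
    (hM : IsUnit M.det) : Function.Injective (latticePoint M) := by
  intro k l h
  have h' := Matrix.mulVec_injective_iff_isUnit.2 ((Matrix.isUnit_iff_isUnit_det M).2 hM) h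
  ext i
  exact_mod_cast congrFun h' i

lemma sympForm_add_left (z z' w : Phase d) :
    sympForm (z + z') w = sympForm z w + sympForm z' w := by
  simp only [sympForm, timePart_add, freqPart_add, inner_add_left, inner_add_right]; ring

lemma sympForm_sub_left (z z' w : Phase d) :
    sympForm (z - z') w = sympForm z w - sympForm z' w := by
  simp only [sympForm, timePart_sub, freqPart_sub, inner_sub_left, inner_sub_right]; ring

lemma sympForm_add_right (z w w' : Phase d) :
    sympForm z (w + w') = sympForm z w + sympForm z w' := by
  simp only [sympForm, timePart_add, freqPart_add, inner_add_left, inner_add_right]; ring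

lemma sympForm_self (z : Phase d) : sympForm z z = 0 := sub_self _

lemma sympForm_eq_dotProduct (z w : Phase d) :
    sympForm z w = z ⬝ᵥ Matrix.J (Fin d) ℝ *ᵥ w := by
  have hw : w = Sum.elim (w ∘ Sum.inl) (w ∘ Sum.inr) := (Sum.elim_comp_inl_inr w).symm
  conv_rhs => rw [hw, Matrix.J, Matrix.fromBlocks_mulVec]
  simp [sympForm, dotProduct, Fintype.sum_sum_type, PiLp.inner_apply, timePart, freqPart,
    Matrix.neg_mulVec, mul_comm, sub_eq_add_neg, add_comm]

/-- Pulling the symplectic form back by M multiplies it by a, and the standard form is integral on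
integer vectors. -/
lemma exists_int_sympForm_latticePoint {M : Matrix (Fin d ⊕ Fin d) (Fin d ⊕ Fin d) ℝ} {a : ℝ}
    (hM : Mᵀ * Matrix.J (Fin d) ℝ * M = a • Matrix.J (Fin d) ℝ) (m : ℤ) (ha : 2 * a = m)
    (k l : Fin d ⊕ Fin d → ℤ) :
    ∃ n : ℤ, 2 * sympForm (latticePoint M k) (latticePoint M l) = n := by
  have h1 : sympForm (latticePoint M k) (latticePoint M l) =
      a * sympForm (fun i => (k i : ℝ)) (fun i => (l i : ℝ)) := by
    rw [sympForm_eq_dotProduct, sympForm_eq_dotProduct, latticePoint, latticePoint,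
      Matrix.mulVec_mulVec,
      Matrix.dotProduct_mulVec, Matrix.vecMul_mulVec, ← Matrix.dotProduct_mulVec,
      ← Matrix.mul_assoc, hM, Matrix.smul_mulVec, dotProduct_smul, smul_eq_mul]
  refine ⟨m * ∑ i, (k (Sum.inr i) * l (Sum.inl i) - l (Sum.inr i) * k (Sum.inl i)), ?_⟩
  rw [h1, ← mul_assoc, ha]
  push_cast
  simp [sympForm, PiLp.inner_apply, timePart, freqPart, mul_comm]

lemma exp_pi_mul_neg_int (n : ℤ) :
    cexp (Real.pi * I * ((-n : ℝ) : ℝ)) = cexp (Real.pi * I * ((n : ℝ) : ℝ)) := by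
  rw [exp_eq_exp_iff_exists_int]
  exact ⟨-n, by push_cast; ring⟩

/-- An odd window in Feichtinger's algebra has no positive lower frame bound over a lattice on
which the symplectic form takes values in `ℤ / 2`. -/
theorem lowerFrameBound_nonpos {g : Space d → ℂ} (hg : MemFeichtinger g)
    (hodd : ∀ᵐ t ∂(volume : Measure (Space d)), g (-t) = -g t)
    {M : Matrix (Fin d ⊕ Fin d) (Fin d ⊕ Fin d) ℝ} (hM : IsUnit M.det)
    (hint : ∀ k l, ∃ n : ℤ, 2 * sympForm (latticePoint M k) (latticePoint M l) = n)
    {A : ℝ} (hA : IsLowerFrameBound g (lattice M) A) : A ≤ 0 := by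
  by_contra! hA0
  set p := latticePoint M with hp
  set c : (Fin d ⊕ Fin d → ℤ) → ℂ := fun k => pairing gaussian (symShift (p k) g) with hc
  set χ : (Fin d ⊕ Fin d → ℤ) → (Fin d ⊕ Fin d → ℤ) → ℂ :=
    fun k l => cexp (Real.pi * I * (sympForm (p (k + k)) (p l) : ℝ)) with hχ
  set κ : ℝ := (2⁻¹ : ℝ) ^ (d / 2 : ℝ) with hκ
  have hκ0 : 0 < κ := by positivity
  have hsum : Summable fun k => ‖c k‖ := by
    have h := ENNReal.summable_toReal (tsum_pairing_symShift_gaussian_ne_top hg hM)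
    rw [← (Equiv.neg (Fin d ⊕ Fin d → ℤ)).summable_iff] at h
    refine h.congr fun k => ?_
    have hk : c k = pairing (symShift (p (-k)) gaussian) g := by
      rw [hp, latticePoint_neg, pairing_symShift_left, neg_neg]
    rw [hk, Function.comp_apply, toReal_enorm]
    rfl
  have hcodd : ∀ k, c (-k) = -c k := fun k => by
    simp only [hc, hp, latticePoint_neg]
    exact pairing_symShift_neg gaussian_neg hodd _
  have hχrefl : ∀ k l, χ (l - k) l = χ k l := by
    intro k l
    obtain ⟨n, hn⟩ := hint k l
    -- As σ(p(l), p(l)) = 0, the reflection only changes the sign of the integer 2σ(p(k), p(l)),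
    -- which exp(πi·) does not see.
    have e1 : sympForm (p (l - k + (l - k))) (p l) = -n := by
      rw [hp, latticePoint_add, latticePoint_sub, sympForm_add_left, sympForm_sub_left,
        sympForm_self, ← hn]
      ring
    have e2 : sympForm (p (k + k)) (p l) = n := by
      rw [hp, latticePoint_add, sympForm_add_left, ← hn]
      ring
    simp only [hχ, e1, e2]
    exact exp_pi_mul_neg_int n
  -- Take ε = Aκ/2, half of the energy per point that the lower bound A would force.
  obtain ⟨F, hFne, hF⟩ := exists_finset_tsum_enorm_sq_sum_le c hsum hcodd χ hχrefl
    (fun k l => norm_exp_pi_mul _) (half_pos (mul_pos hA0 hκ0))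
  set f : Space d → ℂ := fun t => ∑ k ∈ F, symShift (p (k + k)) gaussian t with hf
  have hshift : ∀ k ∈ F, MemLp (symShift (p (k + k)) gaussian) 2 volume :=
    fun k _ => memLp_symShift memLp_gaussian _
  have hfL : MemLp f 2 volume := memLp_finsetSum F hshift
  have hpf : ∀ l, pairing f (symShift (p l) g) = ∑ k ∈ F, χ k l * c (l - (k + k)) := by
    intro l
    rw [hf, pairing_sum_left F _ hshift (memLp_symShift hg.1 _)]
    refine Finset.sum_congr rfl fun k _ => ?_
    rw [pairing_symShift_symShift]
    simp only [hχ, hc, hp, latticePoint_sub]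
  -- On 2Λ the form takes even integer values, so the phase is 1 and the Gram matrix has positive
  -- entries; its diagonal alone gives κ|F| below.
  have hterm : ∀ k l, pairing (symShift (p (k + k)) gaussian) (symShift (p (l + l)) gaussian) =
      (κ * Real.exp (-(Real.pi / 2) * ∑ i, (p (l + l) - p (k + k)) i ^ 2) : ℝ) := by
    intro k l
    obtain ⟨n, hn⟩ := hint k l
    have e : sympForm (p (k + k)) (p (l + l)) = 2 * n := by
      rw [hp, latticePoint_add, latticePoint_add, sympForm_add_left, sympForm_add_right, ← hn]
      ring
    rw [pairing_symShift_symShift, pairing_gaussian_symShift, e,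
      show (Real.pi * I * ((2 * n : ℝ) : ℝ) : ℂ) = n * (2 * Real.pi * I) by push_cast; ring,
      exp_int_mul_two_pi_mul_I, one_mul]
  have hnorm : κ * F.card ≤ (pairing f f).re := by
    rw [hf, pairing_sum_left F _ hshift hfL, re_sum, mul_comm, ← nsmul_eq_mul,
      ← Finset.sum_const]
    refine Finset.sum_le_sum fun k hk => ?_
    rw [pairing_sum_right F _ hshift (hshift k hk), re_sum]
    refine le_trans ?_ (Finset.single_le_sum (fun l _ => ?_) hk)
    · rw [hterm, ofReal_re]
      simp
    · rw [hterm, ofReal_re]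
      positivity
  have hlow := hA f hfL
  have htsum : ∑' z : lattice M, ‖stft g f z‖ₑ ^ 2 =
      ∑' l, ‖∑ k ∈ F, χ k l * c (l - (k + k))‖ₑ ^ 2 := by
    have h := tsum_range (g := p) (fun z => ‖stft g f z‖ₑ ^ 2) (latticePoint_injective hM)
    refine h.trans (tsum_congr fun l => ?_)
    rw [← hpf, ← ofReal_norm, norm_stft, ofReal_norm]
  rw [htsum, eLpNorm_two_sq f hfL, ← ENNReal.ofReal_mul hA0.le] at hlow
  have hcard : (0 : ℝ) < F.card := by exact_mod_cast hFne.card_pos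
  have hfin := (ENNReal.ofReal_le_ofReal_iff (by positivity)).1 (hlow.trans hF)
  nlinarith [mul_pos (mul_pos hA0 hκ0) hcard]

/-- Symplectic matrices have determinant 1, so the volume is c^(2d) and c² = 1/2. For d = 0 the
volume says nothing about c, but the matrices are empty. -/
lemma transpose_mul_J_mul_of_isSymplecticMultiple
    {M : Matrix (Fin d ⊕ Fin d) (Fin d ⊕ Fin d) ℝ} (hvol : |M.det| = ((2 : ℝ) ^ d)⁻¹)
    (hM : IsSymplecticMultiple M) :
    Mᵀ * Matrix.J (Fin d) ℝ * M = (2⁻¹ : ℝ) • Matrix.J (Fin d) ℝ := by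
  rcases Nat.eq_zero_or_pos d with rfl | hd
  · exact Subsingleton.elim _ _
  obtain ⟨c, hc, S, hS, rfl⟩ := hM
  have hc2 : c ^ 2 = 2⁻¹ := by
    rw [Matrix.det_smul, SymplecticGroup.det_eq_one hS, mul_one, Fintype.card_sum,
      Fintype.card_fin, ← two_mul, pow_mul, abs_of_pos (by positivity), ← inv_pow] at hvol
    exact (pow_left_inj₀ (by positivity) (by positivity) hd.ne').1 hvol
  rw [Matrix.transpose_smul, Matrix.smul_mul, Matrix.smul_mul, Matrix.mul_smul, smul_smul,
    SymplecticGroup.mem_iff'.1 hS, ← sq, hc2]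

/-- Alternating forms on the plane are multiples of one another, so no symplectic hypothesis is
needed for d = 1. -/
lemma transpose_mul_J_mul_of_one (M : Matrix (Fin 1 ⊕ Fin 1) (Fin 1 ⊕ Fin 1) ℝ) :
    Mᵀ * Matrix.J (Fin 1) ℝ * M = M.det • Matrix.J (Fin 1) ℝ := by
  have hdet : M.det = M (Sum.inl 0) (Sum.inl 0) * M (Sum.inr 0) (Sum.inr 0) -
      M (Sum.inl 0) (Sum.inr 0) * M (Sum.inr 0) (Sum.inl 0) := by
    rw [← Matrix.det_submatrix_equiv_self finSumFinEquiv.symm, Matrix.det_fin_two]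
    rfl
  rw [hdet]
  ext i j
  rcases i with i | i <;> rcases j with j | j <;> fin_cases i <;> fin_cases j <;>
    simp [Matrix.mul_apply, Fintype.sum_sum_type, Matrix.J, Matrix.transpose_apply] <;> ring

end GaborOdd

end

theorem theorem1 (d : ℕ) (g : GaborOdd.Space d → ℂ) (hg : GaborOdd.MemFeichtinger g)
    (hodd : ∀ᵐ t ∂(volume : Measure (GaborOdd.Space d)), g (-t) = -g t)
    (M : Matrix (Fin d ⊕ Fin d) (Fin d ⊕ Fin d) ℝ) (hvol : |M.det| = ((2 : ℝ) ^ d)⁻¹) :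
    (GaborOdd.IsSymplecticMultiple M →
      ¬ GaborOdd.IsGaborFrame g (GaborOdd.lattice M) ∧
        ∀ A : ℝ, GaborOdd.IsLowerFrameBound g (GaborOdd.lattice M) A → A ≤ 0) ∧
    (d = 1 →
      ¬ GaborOdd.IsGaborFrame g (GaborOdd.lattice M) ∧
        ∀ A : ℝ, GaborOdd.IsLowerFrameBound g (GaborOdd.lattice M) A → A ≤ 0) := by
  have hM : IsUnit M.det := by
    rw [isUnit_iff_ne_zero, ← abs_pos, hvol]
    positivity
  have key : (∃ a : ℝ, Mᵀ * Matrix.J (Fin d) ℝ * M = a • Matrix.J (Fin d) ℝ ∧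
      ∃ m : ℤ, 2 * a = m) → ¬ GaborOdd.IsGaborFrame g (GaborOdd.lattice M) ∧
        ∀ A : ℝ, GaborOdd.IsLowerFrameBound g (GaborOdd.lattice M) A → A ≤ 0 := by
    rintro ⟨a, hJ, m, ha⟩
    have hlow : ∀ A : ℝ, GaborOdd.IsLowerFrameBound g (GaborOdd.lattice M) A → A ≤ 0 :=
      fun A hA => GaborOdd.lowerFrameBound_nonpos hg hodd hM
        (GaborOdd.exists_int_sympForm_latticePoint hJ m ha) hA
    refine ⟨?_, hlow⟩
    rintro ⟨A, B, hA0, -, hA, -⟩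
    exact absurd (hlow A hA) (not_le.2 hA0)
  refine ⟨fun hS => key ⟨2⁻¹, ?_, 1, by norm_num⟩, ?_⟩
  · exact GaborOdd.transpose_mul_J_mul_of_isSymplecticMultiple hvol hS
  · rintro rfl
    refine key ⟨M.det, GaborOdd.transpose_mul_J_mul_of_one M, ?_⟩
    -- The orientation of M is free: det M = ±1/2, and either sign makes 2a an integer.
    rcases abs_choice M.det with h | h <;> rw [h] at hvol
    · exact ⟨1, by rw [hvol]; norm_num⟩
    · exact ⟨-1, by rw [← neg_neg M.det, hvol]; norm_num⟩
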